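/- **Model.** Consider the following forest fire model on $\{0,1,2,\dots\}$. All sites are vacant at time $0$. At every site a tree appears after an exponential time of rate $1$, counted from the moment when the site last became vacant. A tree at site $0$ burns as soon as it appears; the $k$-th tree at $0$ starts fire number $k$. Burning takes no time: a burning tree vanishes at once and its site is vacant again. If fire $k$ burns site $x$ at time $t$, it tries to spread to $x+1$ at time $t+\Delta_x^{(k)}$: if there is a tree at $x+1$ by that time, this tree burns at that time; otherwise fire $k$ stops at $x$. Fires do not overtake one another: if a fire with a smaller number has burnt $x$ and its attempt to spread from $x$ to $x+1$ takes place later than time $t+\Delta_x^{(k)}$, then fire $k$ also stops at $x$. The spreading times $\Delta_x^{(k)}\ge 0$ and the exponential growth times are all independent; for each $x$ the $\Delta_x^{(k)}$, $k\ge1$, are copies of a nonnegative random variable $\Delta_x$ whose distribution may depend on $x$, and the $\Delta_x$, $x\ge0$, are independent. Let $n_k\in\{0,1,2,\dots\}\cup\{\infty\}$ be the right-most site burnt by fire $k$ and $\zeta_k=\sum_{0\le x<n_k}\Delta_x^{(k)}$ its duration. Fire $k$ is an *infinite fire* if $n_k=\infty$ and $\zeta_k=\infty$. **Theorem (non-identically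 distributed $\Delta$'s).** Let $c\in\mathbb R$. 1. Let $c\le 1$, and assume that either (a) almost surely, $\Delta_x\le c/x$ for all large $x$, or (b) for some $C>0$ we have $|\Delta_x|\le C$ almost surely for all $x$, $\sum_x \mathrm{Var}(\Delta_x)<\infty$, and the series $\sum_{x\ge1}\left(\mathbb E\Delta_x-\frac cx\right)$ converges. Then almost surely there is no infinite fire; indeed $\mathbb P(n_k<\infty\text{ for all }k)=1$. 2. Let $c>1$, and assume that either (c) almost surely, $\Delta_x>c/x$ for all large $x$, or (d) $\mathbb E\Delta_x=\frac{c+o(1)}{x}$ as $x\to\infty$, $\mathbb P\left(\lim_{x\to\infty}|\Delta_x|\sqrt x=0\right)=1$, and for some $C>0$ we have $|\Delta_x|\le C$ almost surely for all large $x$. Then almost surely an infinite fire occurs. -/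

import Mathlib

open MeasureTheory ProbabilityTheory Filter Topology

/-!
The forest fire model on `ℕ = {0, 1, 2, …}` with instant burning and delayed spread of fire.

All sites are vacant at time `0`.  Sites, fires and trees are all numbered from `0`.
* `ξ x i` is the time which the `i`-th tree at site `x` takes to appear, counted from the moment
  at which the previous tree at `x` burnt (from time `0` if `i = 0`).
* A tree at the origin burns as soon as it appears; this starts fire `0`, fire `1`, …
* `δ x k` is the time that fire `k` needs in order to spread from site `x` to site `x + 1`.  If fire
  `k` burns `x` at time `t`, it burns `x + 1` at time `t + δ x k` if there is a tree at `x + 1` by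
  that time, and it stops at `x` otherwise.
* Fires do not overtake one another: fire `k` cannot ignite `x + 1` at time `t + δ x k` if
  an earlier fire that burnt `x` has not yet ceased to affect `x + 1`.  As burning takes no time,
  fire `k` then finds no tree when it is its turn, so it stops at `x`.
-/

namespace ForestFire

/-- The time at which fire `k` burns site `x`, if it gets there: the starting time
`ξ 0 0 + ⋯ + ξ 0 k` of the fire plus the spreading times along the sites `0, …, x - 1`. -/
noncomputable def fireTime (ξ δ : ℕ → ℕ → ℝ) (x k : ℕ) : ℝ :=
  ∑ i ∈ Finset.range (k + 1), ξ 0 i + ∑ y ∈ Finset.range x, δ y k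

open Classical in
/-- The history of one site just before fire `k` is dealt with: the number of trees
burnt there by the fires `0, …, k - 1`, and the time of the last of these burnings (`0` if there
was none).  Here `g i` is the time that the `i`-th tree of the site takes to appear, `attempts k`
says that fire `k` tries to ignite the site, and `t k` is the time at which it does so. -/
noncomputable def siteHistory (g : ℕ → ℝ) (attempts : ℕ → Prop) (t : ℕ → ℝ) : ℕ → ℕ × ℝ
  | 0 => (0, 0)
  | k + 1 =>
    let s := siteHistory g attempts t k
    if attempts k ∧ s.2 + g s.1 ≤ t k then (s.1 + 1, t k) else s

/-- Fire `k` tries to ignite site `x + 1`, where `R` is the set of the fires that burn `x`: it burns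
`x`, and no earlier fire that burnt `x` is still on its way from `x` to `x + 1`. -/
def Attempts (ξ δ : ℕ → ℕ → ℝ) (x : ℕ) (R : ℕ → Prop) (k : ℕ) : Prop :=
  R k ∧ ∀ j < k, R j → fireTime ξ δ (x + 1) j ≤ fireTime ξ δ (x + 1) k

/-- `Reaches ξ δ x k`: fire `k` burns site `x`. -/
def Reaches (ξ δ : ℕ → ℕ → ℝ) : ℕ → ℕ → Prop
  | 0 => fun _ => True
  | x + 1 => fun k =>
    Attempts ξ δ x (Reaches ξ δ x) k ∧
      (siteHistory (ξ (x + 1)) (Attempts ξ δ x (Reaches ξ δ x)) (fireTime ξ δ (x + 1)) k).2 +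
        ξ (x + 1)
          (siteHistory (ξ (x + 1)) (Attempts ξ δ x (Reaches ξ δ x)) (fireTime ξ δ (x + 1)) k).1
        ≤ fireTime ξ δ (x + 1) k

/-- The right-most site burnt by fire `k`; it is `⊤` if the fire burns all the sites. -/
noncomputable def rightmost (ξ δ : ℕ → ℕ → ℝ) (k : ℕ) : ℕ∞ :=
  ⨆ (x : ℕ) (_ : Reaches ξ δ x k), (x : ℕ∞)

open Classical in
/-- The duration of fire `k`: the sum of the spreading times along the sites strictly to the left
of the right-most site that it burns. -/
noncomputable def duration (ξ δ : ℕ → ℕ → ℝ) (k : ℕ) : ENNReal :=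
  ∑' y : ℕ, if (y : ℕ∞) < rightmost ξ δ k then ENNReal.ofReal (δ y k) else 0

/-- Fire `k` is an infinite fire. -/
def IsInfiniteFire (ξ δ : ℕ → ℕ → ℝ) (k : ℕ) : Prop :=
  rightmost ξ δ k = ⊤ ∧ duration ξ δ k = ⊤

/-- The randomness that drives the model: the times `ξ x i` are exponential with rate `1`, the
spreading times `Δ x k` are nonnegative with a law that may depend on the site `x` but not on
the fire `k`, and all of these random variables are independent. -/
structure IsDriving {Ω : Type*} [MeasurableSpace Ω] (P : Measure Ω)
    (ξ Δ : ℕ → ℕ → Ω → ℝ) : Prop where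
  measurable_growth : ∀ x i, Measurable (ξ x i)
  measurable_spread : ∀ x k, Measurable (Δ x k)
  law_growth : ∀ x i, P.map (ξ x i) = expMeasure 1
  spread_nonneg : ∀ x k, ∀ᵐ ω ∂P, 0 ≤ Δ x k ω
  identDistrib_spread : ∀ x k, IdentDistrib (Δ x k) (Δ x 0) P P
  indep : iIndepFun
    (Sum.elim (fun p : ℕ × ℕ => ξ p.1 p.2) (fun p : ℕ × ℕ => Δ p.1 p.2)) P

end ForestFire

/-! The first fire to reach a site `x ≥ 1` burns it exactly when it arrives no earlier than the
first growth time `ξ x 0`, whose tail is `exp (-t)`. So everything rests on comparing the sum of the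
spreading times before `x` with `log x`: the hypotheses bound this sum above by `K + log x` in the
first half, and below by `b * log x - K` with `b > 1` in the second, through the harmonic series
and, under moment assumptions, Kolmogorov's one-series theorem.

First half: by induction the earlier fires die, so fire `k` is the first one at all distant sites;
the probabilities that `ξ x 0` exceeds `K + log x` have infinite sum, so some late tree stops it
(`exists_not_reaches`, `ae_rightmost_lt_top`).

Second half: by Borel-Cantelli, the spreading times of one fire outpace all first growth times
beyond `L` with a probability `q_L` that tends to `1`. Some fire reaches `L` (`frequently_reaches`),
but being the first to do so biases its spreading times. The bias is favourable, as this event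
increases in them; Harris' inequality then shows that some fire burns everything with probability at
least `q_L` (`measure_le_measure_exists_reaches`). Let `L` tend to infinity. -/

namespace ForestFire

/-! ### Dynamics for fixed growth and spreading times -/

section Deterministic

variable {ξ δ ξ' δ' : ℕ → ℕ → ℝ}

theorem siteHistory_eq_zero {g : ℕ → ℝ} {A : ℕ → Prop} {t : ℕ → ℝ} {k : ℕ}
    (h : ∀ j < k, ¬ A j) : siteHistory g A t k = (0, 0) := by
  induction k with
  | zero => rfl
  | succ k ih =>
    rw [siteHistory, ih fun j hj => h j (hj.trans k.lt_succ_self)]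
    exact if_neg fun hk => h k k.lt_succ_self hk.1

theorem siteHistory_congr {g : ℕ → ℝ} {A A' : ℕ → Prop} {t t' : ℕ → ℝ} {k : ℕ}
    (hA : ∀ j < k, (A j ↔ A' j)) (ht : ∀ j < k, t j = t' j) :
    siteHistory g A t k = siteHistory g A' t' k := by
  induction k with
  | zero => rfl
  | succ k ih =>
    rw [siteHistory, siteHistory, ih (fun j hj => hA j (hj.trans k.lt_succ_self))
      fun j hj => ht j (hj.trans k.lt_succ_self)]
    have hk := hA k k.lt_succ_self
    split_ifs with h h' h' <;> simp_all

theorem siteHistory_eq_of_le {g : ℕ → ℝ} {A : ℕ → Prop} {t : ℕ → ℝ} {N k : ℕ} (hk : N ≤ k)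
    (h : ∀ j, N ≤ j →
      ¬ (A j ∧ (siteHistory g A t j).2 + g (siteHistory g A t j).1 ≤ t j)) :
    siteHistory g A t k = siteHistory g A t N := by
  induction k, hk using Nat.le_induction with
  | base => rfl
  | succ k hk ih => rw [siteHistory, ← ih]; exact if_neg (h k hk)

theorem reaches_succ {x k : ℕ} : Reaches ξ δ (x + 1) k ↔
    Attempts ξ δ x (Reaches ξ δ x) k ∧
      (siteHistory (ξ (x + 1)) (Attempts ξ δ x (Reaches ξ δ x)) (fireTime ξ δ (x + 1)) k).2 +
        ξ (x + 1)
          (siteHistory (ξ (x + 1)) (Attempts ξ δ x (Reaches ξ δ x)) (fireTime ξ δ (x + 1)) k).1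
        ≤ fireTime ξ δ (x + 1) k := Iff.rfl

theorem Reaches.mono {x y k : ℕ} (hxy : x ≤ y) (h : Reaches ξ δ y k) : Reaches ξ δ x k := by
  induction y, hxy using Nat.le_induction with
  | base => exact h
  | succ y _ ih => exact ih h.1.1

/-- For the first fire at `x` the no-overtaking rule is vacuous, and `x + 1` has never burnt, so
only its tree of index `0`, growing since time `0`, matters. -/
theorem reaches_succ_iff_of_first {x k : ℕ} (h : ∀ j < k, ¬ Reaches ξ δ x j) :
    Reaches ξ δ (x + 1) k ↔ Reaches ξ δ x k ∧ ξ (x + 1) 0 ≤ fireTime ξ δ (x + 1) k := by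
  rw [reaches_succ, siteHistory_eq_zero fun j hj hA => h j hj hA.1, zero_add]
  exact and_congr_left fun _ => ⟨fun hA => hA.1, fun hR => ⟨hR, fun j hj hRj => (h j hj hRj).elim⟩⟩

/-- Beyond the sites where the finitely many earlier fires stop, fire `k` would be the first to
arrive, so a single late first tree there stops it. -/
theorem exists_not_reaches
    (h : ∀ k, ∃ᶠ x : ℕ in atTop, fireTime ξ δ (x + 1) k < ξ (x + 1) 0) (k : ℕ) :
    ∃ x, ¬ Reaches ξ δ x k := by
  induction k using Nat.strong_induction_on with
  | _ k ih =>
    have hev : ∀ᶠ x : ℕ in atTop, ∀ j ∈ Finset.range k, ¬ Reaches ξ δ x j := by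
      rw [Filter.eventually_all_finset]
      intro j hj
      obtain ⟨y, hy⟩ := ih j (Finset.mem_range.1 hj)
      filter_upwards [eventually_ge_atTop y] with x hx hR using hy (hR.mono hx)
    obtain ⟨x, hlt, hx⟩ := ((h k).and_eventually hev).exists
    refine ⟨x + 1, fun hR => ?_⟩
    rw [reaches_succ_iff_of_first fun j hj => hx j (Finset.mem_range.2 hj)] at hR
    exact hlt.not_ge hR.2

theorem rightmost_lt_top {x k : ℕ} (h : ¬ Reaches ξ δ x k) : rightmost ξ δ k < ⊤ := by
  refine lt_of_le_of_lt (iSup₂_le fun y hy => ?_) (ENat.natCast_lt_top x)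
  exact_mod_cast le_of_not_ge fun hxy => h (hy.mono hxy)

theorem rightmost_eq_top {k : ℕ} (h : ∀ x, Reaches ξ δ x k) : rightmost ξ δ k = ⊤ := by
  refine ENat.eq_top_iff_forall_ge.2 fun x => ?_
  exact le_iSup₂_of_le x (h x) le_rfl

theorem isInfiniteFire_of_forall_reaches {k : ℕ} (h : ∀ x, Reaches ξ δ x k)
    (hnonneg : ∀ x, 0 ≤ δ x k)
    (hsum : Tendsto (fun x => ∑ y ∈ Finset.range x, δ y k) atTop atTop) :
    IsInfiniteFire ξ δ k := by
  refine ⟨rightmost_eq_top h, ?_⟩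
  rw [duration, rightmost_eq_top h]
  simp only [ENat.natCast_lt_top, if_true]
  refine tendsto_nhds_unique (ENNReal.tendsto_nat_tsum _) ?_
  refine (ENNReal.tendsto_ofReal_nhds_top.2 hsum).congr fun x => ?_
  exact ENNReal.ofReal_sum_of_nonneg fun y _ => hnonneg y

/-- Earlier fires that miss `L` never get beyond it, so fire `m` stays the first one and meets only
trees of index `0`. -/
theorem reaches_of_first {L m : ℕ} (hfirst : ∀ j < m, ¬ Reaches ξ δ L j) (hL : Reaches ξ δ L m)
    (hξ : ∀ x, L < x → ξ x 0 ≤ fireTime ξ δ x m) (x : ℕ) : Reaches ξ δ x m := by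
  rcases le_total x L with hx | hx
  · exact hL.mono hx
  · induction x, hx using Nat.le_induction with
    | base => exact hL
    | succ x hx ih =>
      exact (reaches_succ_iff_of_first fun j hj hR => hfirst j hj (hR.mono hx)).2
        ⟨ih, hξ _ (Nat.lt_succ_of_le hx)⟩

/-- A sequence tending to infinity along an infinite set of indices has infinitely many records
among these indices. -/
theorem frequently_record {R : ℕ → Prop} (hR : ∃ᶠ k in atTop, R k) {f : ℕ → ℝ}
    (hf : Tendsto f atTop atTop) : ∃ᶠ k in atTop, R k ∧ ∀ j < k, R j → f j ≤ f k := by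
  classical
  rw [frequently_atTop]
  intro N
  -- The least `k ≥ N` in `R` with `V ≤ f k` is a record: values before `N` are at most `V`, and
  -- later ones in `R` stay below `V` by minimality.
  obtain ⟨V, hV⟩ := ((Finset.range N).image f).exists_le
  have hex : ∃ k, N ≤ k ∧ R k ∧ V ≤ f k := by
    obtain ⟨k, hk, h⟩ :=
      (hR.and_eventually ((eventually_ge_atTop N).and (hf.eventually_ge_atTop V))).exists
    exact ⟨k, h.1, hk, h.2⟩
  obtain ⟨hN, hRk, hVk⟩ := Nat.find_spec hex
  refine ⟨_, hN, hRk, fun j hj hRj => ?_⟩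
  rcases lt_or_ge j N with hjN | hjN
  · exact (hV _ (Finset.mem_image_of_mem f (Finset.mem_range.2 hjN))).trans hVk
  · have := Nat.find_min hex hj
    exact (le_of_not_ge fun h => this ⟨hjN, hRj, h⟩).trans hVk

theorem tendsto_fireTime (hδ : ∀ x k, 0 ≤ δ x k)
    (hξ : Tendsto (fun n => ∑ i ∈ Finset.range n, ξ 0 i) atTop atTop) (x : ℕ) :
    Tendsto (fireTime ξ δ x) atTop atTop := by
  refine tendsto_atTop_mono (fun k => ?_) ((tendsto_add_atTop_iff_nat 1).2 hξ)
  exact le_add_of_nonneg_right (Finset.sum_nonneg fun y _ => hδ y k)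

/-- Records of the arrival times provide infinitely many attempts on the next site. If only finitely
many succeeded, its history would freeze with a tree due at a fixed time, and a late attempt would
find that tree. -/
theorem frequently_reaches (hδ : ∀ x k, 0 ≤ δ x k)
    (hξ : Tendsto (fun n => ∑ i ∈ Finset.range n, ξ 0 i) atTop atTop) (x : ℕ) :
    ∃ᶠ k in atTop, Reaches ξ δ x k := by
  induction x with
  | zero => exact Frequently.of_forall fun _ => trivial
  | succ x ih =>
    have ht := tendsto_fireTime hδ hξ (x + 1)
    have hA : ∃ᶠ k in atTop, Attempts ξ δ x (Reaches ξ δ x) k := frequently_record ih ht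
    intro hnot
    obtain ⟨N, hN⟩ := eventually_atTop.1 hnot
    obtain ⟨k, hk, hNk, hle⟩ := (hA.and_eventually
      ((eventually_ge_atTop N).and (ht.eventually_ge_atTop _))).exists
    refine hN k hNk (reaches_succ.2 ⟨hk, ?_⟩)
    rw [siteHistory_eq_of_le hNk fun j hj => hN j hj]
    exact hle

/-- Up to site `L`, the fires before `m` do not depend on the spreading times of fire `m`,
while fire `m` itself profits from longer spreading times. -/
theorem reaches_mono_spread {L m : ℕ} (hξ : ∀ x ≤ L, ξ x = ξ' x)
    (hδ : ∀ x < L, ∀ j < m, δ x j = δ' x j) (hm : ∀ x < L, δ x m ≤ δ' x m) {x : ℕ} (hx : x ≤ L) :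
    (∀ j < m, (Reaches ξ δ x j ↔ Reaches ξ' δ' x j)) ∧
      (Reaches ξ δ x m → Reaches ξ' δ' x m) := by
  have hft : ∀ x ≤ L, ∀ j < m, fireTime ξ δ x j = fireTime ξ' δ' x j := fun x hx j hj => by
    simp only [fireTime, hξ 0 L.zero_le]
    congr 1
    exact Finset.sum_congr rfl fun y hy => hδ y ((Finset.mem_range.1 hy).trans_le hx) j hj
  have hftm : ∀ x ≤ L, fireTime ξ δ x m ≤ fireTime ξ' δ' x m := fun x hx => by
    simp only [fireTime, hξ 0 L.zero_le]
    gcongr with y hy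
    exact hm y ((Finset.mem_range.1 hy).trans_le hx)
  induction x with
  | zero => exact ⟨fun _ _ => Iff.rfl, id⟩
  | succ x ih =>
    obtain ⟨ih1, ih2⟩ := ih (Nat.le_of_succ_le hx)
    have hA : ∀ j < m, (Attempts ξ δ x (Reaches ξ δ x) j ↔
        Attempts ξ' δ' x (Reaches ξ' δ' x) j) := fun j hj => by
      refine and_congr (ih1 j hj) (forall₂_congr fun i hi => ?_)
      rw [ih1 i (hi.trans hj), hft _ hx i (hi.trans hj), hft _ hx j hj]
    have hH : ∀ j ≤ m, siteHistory (ξ (x + 1)) (Attempts ξ δ x (Reaches ξ δ x))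
        (fireTime ξ δ (x + 1)) j = siteHistory (ξ' (x + 1)) (Attempts ξ' δ' x (Reaches ξ' δ' x))
        (fireTime ξ' δ' (x + 1)) j := fun j hj => by
      rw [hξ _ hx]
      exact siteHistory_congr (fun i hi => hA i (hi.trans_le hj))
        fun i hi => hft _ hx i (hi.trans_le hj)
    refine ⟨fun j hj => ?_, fun hR => ?_⟩
    · rw [reaches_succ, reaches_succ, hA j hj, hH j hj.le, hft _ hx j hj, hξ _ hx]
    -- Arriving later helps fire `m` twice: it overtakes no one, and the tree has had more time to
    -- appear.
    · rw [reaches_succ, hH m le_rfl, hξ _ hx] at hR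
      refine reaches_succ.2 ⟨⟨ih2 hR.1.1, fun j hj hRj => ?_⟩, hR.2.trans (hftm _ hx)⟩
      rw [← hft _ hx j hj]
      exact (hR.1.2 j hj ((ih1 j hj).2 hRj)).trans (hftm _ hx)

end Deterministic

/-! ### Independence of blocks and positive association -/

section Harris

open scoped ENNReal

/-- **Chebyshev's association inequality**: increasing functions of one real random variable are
positively correlated. -/
theorem lintegral_mul_lintegral_le_of_monotone (μ : Measure ℝ) [IsProbabilityMeasure μ]
    {f g : ℝ → ℝ≥0∞} (hf : Monotone f) (hg : Monotone g) :
    (∫⁻ t, f t ∂μ) * ∫⁻ t, g t ∂μ ≤ ∫⁻ t, f t * g t ∂μ := by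
  have hfm := hf.measurable
  have hgm := hg.measurable
  -- This is `0 ≤ (f t - f s) * (g t - g s)`, phrased with increments `a`, `b` because subtraction
  -- in `ℝ≥0∞` truncates.
  have hle' : ∀ s t, s ≤ t → f s * g t + f t * g s ≤ f s * g s + f t * g t := fun s t h => by
    obtain ⟨a, ha⟩ := exists_add_of_le (hf h)
    obtain ⟨b, hb⟩ := exists_add_of_le (hg h)
    rw [ha, hb, show f s * g s + (f s + a) * (g s + b) =
      f s * (g s + b) + (f s + a) * g s + a * b by ring]
    exact le_self_add
  have hle : ∀ s t, f s * g t + f t * g s ≤ f s * g s + f t * g t := fun s t => by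
    rcases le_total s t with h | h
    · exact hle' s t h
    · rw [add_comm, add_comm (f s * g s)]
      exact hle' t s h
  have h2 : 2 * ((∫⁻ t, f t ∂μ) * ∫⁻ t, g t ∂μ) ≤ 2 * ∫⁻ t, f t * g t ∂μ :=
    calc 2 * ((∫⁻ t, f t ∂μ) * ∫⁻ t, g t ∂μ)
        = ∫⁻ s, ∫⁻ t, (f s * g t + f t * g s) ∂μ ∂μ := by
          have : ∀ s, ∫⁻ t, (f s * g t + f t * g s) ∂μ =
              f s * (∫⁻ t, g t ∂μ) + (∫⁻ t, f t ∂μ) * g s := fun s => by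
            rw [lintegral_add_left (by fun_prop), lintegral_const_mul _ hgm,
              lintegral_mul_const _ hfm]
          simp_rw [this]
          rw [lintegral_add_left (by fun_prop), lintegral_mul_const _ hfm,
            lintegral_const_mul _ hgm, two_mul]
      _ ≤ ∫⁻ s, ∫⁻ t, (f s * g s + f t * g t) ∂μ ∂μ :=
          lintegral_mono fun s => lintegral_mono fun t => hle s t
      _ = 2 * ∫⁻ t, f t * g t ∂μ := by
          have : ∀ s, ∫⁻ t, (f s * g s + f t * g t) ∂μ =
              f s * g s + ∫⁻ t, f t * g t ∂μ := fun s => by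
            rw [lintegral_add_left (by fun_prop)]; simp
          simp_rw [this]
          rw [lintegral_add_left (by fun_prop)]
          simp [two_mul]
  exact (ENNReal.mul_le_mul_iff_right two_ne_zero ENNReal.ofNat_ne_top).1 h2

variable {Ω ι : Type*} [MeasurableSpace Ω] {P : Measure Ω} {Z : ι → Ω → ℝ}

/-- Disjoint blocks of independent random variables are independent. -/
theorem measure_inter_of_disjoint (hZ : iIndepFun Z P) (hm : ∀ i, Measurable (Z i))
    {S T : Set ι} (hST : Disjoint S T) {B C : Set (ι → ℝ)}
    (hB : MeasurableSet B) (hC : MeasurableSet C)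
    (hBS : ∀ z z' : ι → ℝ, (∀ i ∈ S, z i = z' i) → z ∈ B → z' ∈ B)
    (hCT : ∀ z z' : ι → ℝ, (∀ i ∈ T, z i = z' i) → z ∈ C → z' ∈ C) :
    P {ω | (fun i => Z i ω) ∈ B ∧ (fun i => Z i ω) ∈ C} =
      P {ω | (fun i => Z i ω) ∈ B} * P {ω | (fun i => Z i ω) ∈ C} := by
  classical
  have key : ∀ (U : Set ι) (D : Set (ι → ℝ)), MeasurableSet D →
      (∀ z z' : ι → ℝ, (∀ i ∈ U, z i = z' i) → z ∈ D → z' ∈ D) →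
      MeasurableSet[⨆ i ∈ U, MeasurableSpace.comap (Z i) inferInstance]
        {ω | (fun i => Z i ω) ∈ D} := by
    intro U D hD hDU
    have heq : {ω | (fun i => Z i ω) ∈ D} =
        (fun ω i => if i ∈ U then Z i ω else 0) ⁻¹' D := by
      ext ω
      exact ⟨fun h => hDU _ _ (fun i hi => (if_pos hi).symm) h,
        fun h => hDU _ _ (fun i hi => if_pos hi) h⟩
    rw [heq]
    refine MeasurableSet.preimage hD
      (@measurable_pi_lambda _ _ _ (_) _ _ fun i => ?_)
    by_cases hi : i ∈ U
    · simp only [hi, if_true]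
      exact (comap_measurable (Z i)).mono
        (le_iSup₂ (f := fun i _ => MeasurableSpace.comap (Z i) inferInstance) i hi) le_rfl
    · simp only [hi, if_false]
      exact measurable_const
  exact (Indep_iff _ _ P).1 (indep_iSup_of_disjoint (fun i => (hm i).comap_le) hZ hST) _ _
    (key S B hB hBS) (key T C hC hCT)

/-- One coordinate of a family of independent random variables may be resampled. -/
theorem measure_eq_lintegral_update [DecidableEq ι] (hZ : iIndepFun Z P)
    (hm : ∀ i, Measurable (Z i)) (i : ι) {B : Set (ι → ℝ)} (hB : MeasurableSet B) :
    P {ω | (fun j => Z j ω) ∈ B} =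
      ∫⁻ t, P {ω | Function.update (fun j => Z j ω) i t ∈ B} ∂(P.map (Z i)) := by
  have := hZ.isProbabilityMeasure
  -- `W` forgets coordinate `i`, hence is independent of `Z i`, yet it determines every resampled
  -- configuration.
  set W : Ω → ι → ℝ := fun ω => Function.update (fun j => Z j ω) i 0 with hW
  have hWm : Measurable W := by
    refine measurable_pi_lambda _ fun j => ?_
    by_cases hj : j = i
    · subst hj; simp [hW]
    · simpa [hW, hj] using hm j
  have hind : IndepFun (Z i) W P := by
    rw [indepFun_iff_measure_inter_preimage_eq_mul]
    intro s t hs ht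
    have h := measure_inter_of_disjoint hZ hm (S := {i}) (T := {i}ᶜ) disjoint_compl_right
      (B := {z | z i ∈ s}) (C := {z | Function.update z i 0 ∈ t})
      (measurable_pi_apply i hs) (by
        refine (measurable_pi_lambda (fun z : ι → ℝ => Function.update z i 0) fun j => ?_) ht
        by_cases hj : j = i
        · subst hj; simp
        · simpa [hj] using measurable_pi_apply j)
      (fun z z' h hz => by simpa [← h i rfl] using hz)
      (fun z z' h hz => by
        have : Function.update z i 0 = Function.update z' i 0 := by
          ext j
          by_cases hj : j = i
          · subst hj; simp
          · simpa [hj] using h j hj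
        simpa [← this] using hz)
    exact h
  have hu : Measurable fun p : ℝ × (ι → ℝ) => Function.update p.2 i p.1 := by
    refine measurable_pi_lambda _ fun j => ?_
    by_cases hj : j = i
    · subst hj; simpa using measurable_fst
    · simpa [hj] using measurable_snd.eval
  have hmap := (indepFun_iff_map_prod_eq_prod_map_map (hm i).aemeasurable hWm.aemeasurable).1 hind
  have h1 : P {ω | (fun j => Z j ω) ∈ B} =
      P.map (fun ω => (Z i ω, W ω)) ((fun p => Function.update p.2 i p.1) ⁻¹' B) := by
    rw [Measure.map_apply ((hm i).prodMk hWm) (hu hB)]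
    congr 1
    ext ω
    simp [hW]
  have := Measure.isProbabilityMeasure_map (μ := P) hWm.aemeasurable
  rw [h1, hmap, Measure.prod_apply (hu hB)]
  refine lintegral_congr fun t => ?_
  rw [Measure.map_apply hWm (measurable_prodMk_left (hu hB))]
  congr 1
  ext ω
  simp [hW]

/-- **Harris' inequality** for two events that both increase in the coordinates in `F`, but otherwise
depend on disjoint blocks of coordinates. -/
theorem mul_measure_le_measure_inter (hZ : iIndepFun Z P) (hm : ∀ i, Measurable (Z i))
    {S T : Set ι} (hST : Disjoint S T) (F : Finset ι) (hS : ∀ i ∈ F, i ∉ S) (hT : ∀ i ∈ F, i ∉ T)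
    {B C : Set (ι → ℝ)} (hB : MeasurableSet B) (hC : MeasurableSet C)
    (hBS : ∀ z z' : ι → ℝ, (∀ i ∈ S, z i = z' i) → (∀ i ∈ F, z i ≤ z' i) → z ∈ B → z' ∈ B)
    (hCT : ∀ z z' : ι → ℝ, (∀ i ∈ T, z i = z' i) → (∀ i ∈ F, z i ≤ z' i) → z ∈ C → z' ∈ C) :
    P {ω | (fun i => Z i ω) ∈ B} * P {ω | (fun i => Z i ω) ∈ C} ≤
      P {ω | (fun i => Z i ω) ∈ B ∧ (fun i => Z i ω) ∈ C} := by
  classical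
  have := hZ.isProbabilityMeasure
  induction F using Finset.induction_on generalizing B C with
  | empty =>
    exact (measure_inter_of_disjoint hZ hm hST hB hC (fun z z' h => hBS z z' h (by simp))
      fun z z' h => hCT z z' h (by simp)).ge
  | insert i F hi ih =>
    have hu : ∀ t, Measurable fun z : ι → ℝ => Function.update z i t := fun t => by
      refine measurable_pi_lambda _ fun j => ?_
      by_cases hj : j = i
      · subst hj; simp
      · simpa [hj] using measurable_pi_apply j
    have hstep : ∀ (t : ℝ) (U : Set ι) (D : Set (ι → ℝ)),
        (∀ z z' : ι → ℝ, (∀ j ∈ U, z j = z' j) → (∀ j ∈ insert i F, z j ≤ z' j) → z ∈ D → z' ∈ D) →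
        ∀ z z' : ι → ℝ, (∀ j ∈ U, z j = z' j) → (∀ j ∈ F, z j ≤ z' j) →
          z ∈ (fun z : ι → ℝ => Function.update z i t) ⁻¹' D →
          z' ∈ (fun z : ι → ℝ => Function.update z i t) ⁻¹' D := by
      intro t U D hD z z' hU hF
      refine hD _ _ (fun j hj => ?_) fun j hj => ?_
      · by_cases hji : j = i
        · subst hji; simp
        · simpa [hji] using hU j hj
      · by_cases hji : j = i
        · subst hji; simp
        · simpa [hji] using hF j ((Finset.mem_insert.1 hj).resolve_left hji)
    have hmono : ∀ (U : Set ι) (D : Set (ι → ℝ)), i ∉ U →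
        (∀ z z' : ι → ℝ, (∀ j ∈ U, z j = z' j) → (∀ j ∈ insert i F, z j ≤ z' j) → z ∈ D → z' ∈ D) →
        Monotone fun t => P {ω | Function.update (fun j => Z j ω) i t ∈ D} := by
      intro U D hiU hD s t hst
      refine measure_mono fun ω hω => hD _ _ (fun j hj => ?_) (fun j _ => ?_) hω
      · have hji : j ≠ i := fun h => hiU (h ▸ hj)
        simp [hji]
      · by_cases hji : j = i
        · subst hji; simpa using hst
        · simp [hji]
    have := Measure.isProbabilityMeasure_map (μ := P) (hm i).aemeasurable
    have hBC := measure_eq_lintegral_update hZ hm i (hB.inter hC)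
    rw [measure_eq_lintegral_update hZ hm i hB, measure_eq_lintegral_update hZ hm i hC]
    -- The slice probabilities increase in the value `t` of coordinate `i`, so Chebyshev's
    -- inequality applies to them; for each fixed `t` the induction hypothesis handles the slices.
    refine (lintegral_mul_lintegral_le_of_monotone _
      (hmono S B (hS i (Finset.mem_insert_self i F)) hBS)
      (hmono T C (hT i (Finset.mem_insert_self i F)) hCT)).trans ?_
    refine le_trans (lintegral_mono fun t => ?_) hBC.ge
    exact ih (fun j hj => hS j (Finset.mem_insert_of_mem hj))
      (fun j hj => hT j (Finset.mem_insert_of_mem hj)) (hu t hB) (hu t hC)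
      (hstep t S B hBS) (hstep t T C hCT)

end Harris

/-! ### Measurability of the burning events -/

section Measurability

variable {E : Type*} [MeasurableSpace E] {ξ δ : E → ℕ → ℕ → ℝ}

theorem measurable_fireTime (hξ : ∀ x i, Measurable fun z => ξ z x i)
    (hδ : ∀ x k, Measurable fun z => δ z x k) (x k : ℕ) :
    Measurable fun z => fireTime (ξ z) (δ z) x k := by
  unfold fireTime
  fun_prop

/-- The index of the current tree is itself random; having countably many values, it may be
substituted measurably. -/
theorem measurableSet_historyAge {g : E → ℕ → ℝ} (hg : ∀ i, Measurable fun z => g z i)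
    {s : E → ℕ × ℝ} (hs : Measurable s) {t : E → ℝ} (ht : Measurable t) :
    MeasurableSet {z | (s z).2 + g z (s z).1 ≤ t z} := by
  have hgs : Measurable fun z => g z (s z).1 :=
    (measurable_from_prod_countable_left (f := fun p : E × ℕ => g p.1 p.2) hg).comp
      (measurable_id.prodMk hs.fst)
  exact measurableSet_le (hs.snd.add hgs) ht

theorem measurable_siteHistory {g : E → ℕ → ℝ} (hg : ∀ i, Measurable fun z => g z i)
    {A : E → ℕ → Prop} (hA : ∀ k, MeasurableSet {z | A z k})
    {t : E → ℕ → ℝ} (ht : ∀ k, Measurable fun z => t z k) (k : ℕ) :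
    Measurable fun z => siteHistory (g z) (A z) (t z) k := by
  classical
  induction k with
  | zero => exact measurable_const
  | succ k ih =>
    simp only [siteHistory]
    refine Measurable.ite ((hA k).inter (measurableSet_historyAge hg ih (ht k))) ?_ ih
    exact (ih.fst.add_const 1).prodMk (ht k)

theorem measurableSet_reaches (hξ : ∀ x i, Measurable fun z => ξ z x i)
    (hδ : ∀ x k, Measurable fun z => δ z x k) (x k : ℕ) :
    MeasurableSet {z | Reaches (ξ z) (δ z) x k} := by
  induction x generalizing k with
  | zero => exact MeasurableSet.univ
  | succ x ih =>
    have ht := measurable_fireTime hξ hδ (x + 1)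
    have hA : ∀ k, MeasurableSet
        {z | Attempts (ξ z) (δ z) x (Reaches (ξ z) (δ z) x) k} := fun k => by
      refine (ih k).inter (?_ : MeasurableSet {z | ∀ j < k, Reaches (ξ z) (δ z) x j →
        fireTime (ξ z) (δ z) (x + 1) j ≤ fireTime (ξ z) (δ z) (x + 1) k})
      simp only [Set.ofPred_forall]
      refine MeasurableSet.iInter fun j => MeasurableSet.iInter fun _ => ?_
      exact (ih j).imp (measurableSet_le (ht j) (ht k))
    exact (hA k).inter (measurableSet_historyAge (hξ (x + 1))
      (measurable_siteHistory (hξ (x + 1)) hA ht k) (ht k))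

end Measurability

/-! ### Borel-Cantelli, Kolmogorov and harmonic sums -/

section Series

variable {Ω : Type*} [MeasurableSpace Ω] {P : Measure Ω}

/-- The second Borel-Cantelli lemma for independent random variables. -/
theorem ae_frequently_mem_of_tsum_eq_top {X : ℕ → Ω → ℝ} (hX : iIndepFun X P)
    (hm : ∀ n, Measurable (X n)) {B : ℕ → Set ℝ} (hB : ∀ n, MeasurableSet (B n))
    (h : ∑' n, P (X n ⁻¹' B n) = ⊤) : ∀ᵐ ω ∂P, ∃ᶠ n in atTop, X n ω ∈ B n := by
  have := hX.isProbabilityMeasure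
  have hBm : ∀ n, MeasurableSet (X n ⁻¹' B n) := fun n => hm n (hB n)
  have hind : iIndepSet (fun n => X n ⁻¹' B n) P :=
    (iIndepSet_iff_meas_biInter hBm).2 fun s =>
      hX.measure_inter_preimage_eq_mul s fun i _ => hB i
  have h1 := measure_limsup_eq_one hBm hind h
  rw [← mem_ae_iff_prob_eq_one (MeasurableSet.measurableSet_limsup hBm)] at h1
  filter_upwards [h1] with ω hω using Filter.mem_limsup_iff_frequently_mem.1 hω

/-- **Kolmogorov's one-series theorem**, as a bound on the partial sums. -/
theorem ae_bounded_sum_sub_integral {X : ℕ → Ω → ℝ} (hX : iIndepFun X P)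
    (hm : ∀ n, Measurable (X n)) (h2 : ∀ n, MemLp (X n) 2 P)
    (hv : Summable fun n => variance (X n) P) :
    ∀ᵐ ω ∂P, ∃ K : ℝ, ∀ N, |∑ n ∈ Finset.range N, (X n ω - ∫ ω', X n ω' ∂P)| ≤ K := by
  have := hX.isProbabilityMeasure
  set Y : ℕ → Ω → ℝ := fun n ω => X n ω - ∫ ω', X n ω' ∂P with hY
  have hYm : ∀ n, StronglyMeasurable (Y n) := fun n =>
    ((hm n).sub_const _).stronglyMeasurable
  have hYi : iIndepFun Y P := hX.comp (fun n t => t - ∫ ω', X n ω' ∂P) fun n => by fun_prop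
  have hY2 : ∀ n, MemLp (Y n) 2 P := fun n => (h2 n).sub (memLp_const _)
  have hY1 : ∀ n, Integrable (Y n) P := fun n => (hY2 n).integrable one_le_two
  have hY0 : ∀ n, ∫ ω, Y n ω ∂P = 0 := fun n => by
    simp [hY, integral_sub ((h2 n).integrable one_le_two)]
  have hYv : ∀ n, variance (Y n) P = variance (X n) P := fun n =>
    variance_sub_const (hm n).aestronglyMeasurable _
  set ℱ := Filtration.natural Y hYm
  -- With `N + 1` terms, `M N` is adapted to `ℱ N`, and the next increment `Y (N + 1)` is
  -- independent of `ℱ N`.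
  set M : ℕ → Ω → ℝ := fun N ω => ∑ n ∈ Finset.range (N + 1), Y n ω with hM
  have hM2 : ∀ N, MemLp (M N) 2 P := fun N => memLp_finsetSum _ fun n _ => hY2 n
  have hMa : StronglyAdapted ℱ M := fun N =>
    Finset.stronglyMeasurable_fun_sum _ fun n hn =>
      ((Filtration.stronglyAdapted_natural hYm) n).mono
        (ℱ.mono (Nat.lt_succ_iff.1 (Finset.mem_range.1 hn)))
  have hmart : Martingale M ℱ P := by
    refine martingale_nat hMa (fun N => (hM2 N).integrable one_le_two) fun N => ?_
    have hsucc : M (N + 1) = M N + Y (N + 1) := by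
      ext ω; simp [hM, Finset.sum_range_succ _ (N + 1)]
    have h1 := condExp_add (μ := P) ((hM2 N).integrable one_le_two) (hY1 (N + 1)) (ℱ N)
    have h2 := iIndepFun.condExp_natural_ae_eq_of_lt hYm hYi N.lt_succ_self
    have h3 := condExp_of_stronglyMeasurable (ℱ.le N) (hMa N) ((hM2 N).integrable one_le_two)
    rw [hsucc]
    filter_upwards [h1, h2] with ω h1 h2
    rw [h1, Pi.add_apply, h2, h3, hY0, add_zero]
  -- Orthogonality bounds the `L²` norms by the summed variances, and so gives the `L¹` bound that
  -- martingale convergence needs.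
  have hbd : ∀ N, eLpNorm (M N) 1 P ≤
      (ENNReal.ofReal (∑' n, variance (X n) P) ^ (2⁻¹ : ℝ)).toNNReal := fun N => by
    rw [ENNReal.coe_toNNReal (ENNReal.rpow_ne_top_of_nonneg (by norm_num) ENNReal.ofReal_ne_top)]
    refine (eLpNorm_le_eLpNorm_of_exponent_le one_le_two (hM2 N).1).trans ?_
    have hMv : variance (M N) P = ∑ n ∈ Finset.range (N + 1), variance (X n) P := by
      have := IndepFun.variance_sum (μ := P) (X := Y) (s := Finset.range (N + 1))
        (fun n _ => hY2 n) fun i _ j _ hij => hYi.indepFun hij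
      rw [Finset.sum_congr rfl fun n _ => (hYv n).symm, ← this]
      congr 1
      ext ω; simp [hM]
    have hM0 : ∫ ω, M N ω ∂P = 0 := by
      rw [integral_finsetSum _ fun n _ => hY1 n]
      exact Finset.sum_eq_zero fun n _ => hY0 n
    have hev : evariance (M N) P ≤ ENNReal.ofReal (∑' n, variance (X n) P) := by
      rw [← (hM2 N).ofReal_variance_eq, hMv]
      exact ENNReal.ofReal_le_ofReal (hv.sum_le_tsum _ fun n _ => variance_nonneg _ _)
    rw [eLpNorm_eq_lintegral_rpow_enorm_toReal two_ne_zero ENNReal.ofNat_ne_top]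
    simp only [ENNReal.toReal_ofNat, one_div]
    refine ENNReal.rpow_le_rpow (le_of_eq_of_le ?_ hev) (by norm_num)
    simp [evariance, hM0]
  filter_upwards [hmart.submartingale.exists_ae_tendsto_of_bdd hbd] with ω ⟨l, hl⟩
  obtain ⟨K, hK⟩ := hl.abs.bddAbove_range
  refine ⟨max K 0, fun N => ?_⟩
  cases N with
  | zero => simp
  | succ N => exact le_max_of_le_left (hK ⟨N, rfl⟩)

theorem exists_sum_le_of_eventually_le {a b : ℕ → ℝ} (h : ∀ᶠ n in atTop, a n ≤ b n) :
    ∃ K : ℝ, ∀ N, ∑ n ∈ Finset.range N, a n ≤ K + ∑ n ∈ Finset.range N, b n := by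
  obtain ⟨n₀, hn₀⟩ := eventually_atTop.1 h
  refine ⟨∑ n ∈ Finset.range n₀, |a n - b n|, fun N => ?_⟩
  rw [← sub_le_iff_le_add, ← Finset.sum_sub_distrib]
  calc ∑ n ∈ Finset.range N, (a n - b n)
      ≤ ∑ n ∈ Finset.range N, (if n < n₀ then |a n - b n| else 0) := by
        refine Finset.sum_le_sum fun n _ => ?_
        split_ifs with hn
        · exact le_abs_self _
        · exact sub_nonpos.2 (hn₀ n (not_lt.1 hn))
    _ = ∑ n ∈ (Finset.range N).filter (· < n₀), |a n - b n| := (Finset.sum_filter _ _).symm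
    _ ≤ _ := by
        refine Finset.sum_le_sum_of_subset_of_nonneg (fun n hn => ?_) fun _ _ _ => abs_nonneg _
        exact Finset.mem_range.2 (Finset.mem_filter.1 hn).2

/-- The term `y = 0` is harmless because `1 / 0 = 0`. -/
theorem sum_range_inv_eq_harmonic (n : ℕ) :
    ∑ y ∈ Finset.range (n + 1), (1 : ℝ) / y = harmonic n := by
  rw [Finset.sum_range_succ']
  simp [harmonic]

theorem sum_range_inv_le (N : ℕ) : ∑ y ∈ Finset.range N, (1 : ℝ) / y ≤ 1 + Real.log N := by
  cases N with
  | zero => simp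
  | succ n =>
    rw [sum_range_inv_eq_harmonic]
    refine (harmonic_le_one_add_log n).trans ?_
    rcases n.eq_zero_or_pos with rfl | hn
    · simp
    · gcongr
      simp

theorem log_le_sum_range_inv (N : ℕ) : Real.log N ≤ ∑ y ∈ Finset.range N, (1 : ℝ) / y := by
  cases N with
  | zero => simp
  | succ n =>
    rw [sum_range_inv_eq_harmonic]
    exact_mod_cast log_add_one_le_harmonic n

/-! ### Logarithmic bounds on sums of spreading times -/

variable {X : ℕ → Ω → ℝ}

theorem ae_sum_le_log_of_eventually_le {c : ℝ} (hc : c ≤ 1)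
    (h : ∀ᵐ ω ∂P, ∀ᶠ x : ℕ in atTop, X x ω ≤ c / x) :
    ∀ᵐ ω ∂P, ∃ K : ℕ, ∀ N : ℕ, ∑ y ∈ Finset.range N, X y ω ≤ K + Real.log N := by
  filter_upwards [h] with ω hω
  obtain ⟨K, hK⟩ := exists_sum_le_of_eventually_le (b := fun n : ℕ => (1 : ℝ) / n)
    (hω.mono fun n hn => hn.trans (by gcongr))
  obtain ⟨K', hK'⟩ := exists_nat_ge (K + 1)
  exact ⟨K', fun N => by linarith [hK N, sum_range_inv_le N]⟩

theorem ae_sum_le_log_of_summable_variance (hX : iIndepFun X P)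
    (hm : ∀ n, Measurable (X n)) {c : ℝ} (hc : c ≤ 1) {C : ℝ}
    (hC : ∀ x, ∀ᵐ ω ∂P, |X x ω| ≤ C) (hv : Summable fun n => variance (X n) P) {l : ℝ}
    (hl : Tendsto (fun N : ℕ => ∑ x ∈ Finset.Icc 1 N, ((∫ ω, X x ω ∂P) - c / x)) atTop (𝓝 l)) :
    ∀ᵐ ω ∂P, ∃ K : ℕ, ∀ N : ℕ, ∑ y ∈ Finset.range N, X y ω ≤ K + Real.log N := by
  have := hX.isProbabilityMeasure
  have h2 : ∀ n, MemLp (X n) 2 P := fun n =>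
    MemLp.of_bound (hm n).aestronglyMeasurable C (hC n)
  obtain ⟨K₁, hK₁⟩ := hl.bddAbove_range
  have hE : ∀ N : ℕ, ∑ y ∈ Finset.range N, (∫ ω, X y ω ∂P) ≤
      max K₁ 0 + |∫ ω, X 0 ω ∂P| + ∑ y ∈ Finset.range N, (1 : ℝ) / y := fun N => by
    cases N with
    | zero => simp; positivity
    | succ n =>
      have h1 : ∑ y ∈ Finset.range (n + 1), ((∫ ω, X y ω ∂P) - c / y) =
          (∫ ω, X 0 ω ∂P) + ∑ y ∈ Finset.Icc 1 n, ((∫ ω, X y ω ∂P) - c / y) := by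
        rw [Finset.range_eq_Ico, Finset.sum_eq_sum_Ico_succ_bot n.succ_pos]
        simp [Finset.Ico_add_one_right_eq_Icc]
      rw [Finset.sum_sub_distrib] at h1
      have h3 : ∑ y ∈ Finset.range (n + 1), c / y ≤ ∑ y ∈ Finset.range (n + 1), (1 : ℝ) / y :=
        Finset.sum_le_sum fun y _ => by gcongr
      have h4 := hK₁ ⟨n, rfl⟩
      simp only at h4
      linarith [le_abs_self (∫ ω, X 0 ω ∂P), le_max_left K₁ 0]
  filter_upwards [ae_bounded_sum_sub_integral hX hm h2 hv] with ω ⟨K₂, hK₂⟩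
  obtain ⟨K, hK⟩ := exists_nat_ge (max K₁ 0 + |∫ ω, X 0 ω ∂P| + K₂ + 1)
  refine ⟨K, fun N => ?_⟩
  have h5 := (abs_le.1 (hK₂ N)).2
  rw [Finset.sum_sub_distrib] at h5
  linarith [hE N, sum_range_inv_le N]

theorem ae_log_le_sum_of_eventually_lt {c : ℝ} (hc : 1 < c)
    (h : ∀ᵐ ω ∂P, ∀ᶠ x : ℕ in atTop, c / x < X x ω) :
    ∀ᵐ ω ∂P, ∃ K : ℕ, ∀ N : ℕ, c * Real.log N ≤ K + ∑ y ∈ Finset.range N, X y ω := by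
  filter_upwards [h] with ω hω
  obtain ⟨K, hK⟩ := exists_sum_le_of_eventually_le (hω.mono fun n hn => hn.le)
  obtain ⟨K', hK'⟩ := exists_nat_ge K
  refine ⟨K', fun N => ?_⟩
  have h1 := hK N
  simp only [div_eq_mul_one_div c, ← Finset.mul_sum] at h1
  have := mul_le_mul_of_nonneg_left (log_le_sum_range_inv N) (zero_le_one.trans hc.le)
  linarith

/-- Truncation at `1 / √n` makes the variances `O(n ^ (-3 / 2))`, since `E Y² ≤ r E X`, while
changing the means only by a summable amount. The one-series theorem then applies to the truncated
variables, which lie below the original ones. -/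
theorem ae_log_le_sum_of_tendsto_integral (hX : iIndepFun X P)
    (hm : ∀ n, Measurable (X n)) (hnonneg : ∀ n, ∀ᵐ ω ∂P, 0 ≤ X n ω) {b c : ℝ} (hb : 0 ≤ b)
    (hbc : b < c) (hE : Tendsto (fun x : ℕ => (x : ℝ) * ∫ ω, X x ω ∂P) atTop (𝓝 c))
    (h0 : ∀ᵐ ω ∂P, Tendsto (fun x : ℕ => |X x ω| * √(x : ℝ)) atTop (𝓝 0)) {C : ℝ}
    (hC : ∀ᶠ x : ℕ in atTop, ∀ᵐ ω ∂P, |X x ω| ≤ C) :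
    ∀ᵐ ω ∂P, ∃ K : ℕ, ∀ N : ℕ, b * Real.log N ≤ K + ∑ y ∈ Finset.range N, X y ω := by
  have := hX.isProbabilityMeasure
  set r : ℕ → ℝ := fun n => 1 / √(n : ℝ) with hr
  have hr0 : ∀ n, 0 ≤ r n := fun n => by positivity
  -- Otherwise the second Borel-Cantelli lemma would give `X n * √n > 1` infinitely often, against
  -- `h0`.
  have hp : ∑' n, P (X n ⁻¹' Set.Ioi (r n)) ≠ ⊤ := fun htop => by
    have h1 := ae_frequently_mem_of_tsum_eq_top hX hm (fun n => measurableSet_Ioi) htop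
    obtain ⟨ω, hω, hω0⟩ := (h1.and h0).exists
    obtain ⟨n, hn, hlt, hpos⟩ := (hω.and_eventually
      ((hω0.eventually_lt_const one_pos).and (eventually_gt_atTop 0))).exists
    have hsq : 0 < √(n : ℝ) := Real.sqrt_pos.2 (Nat.cast_pos.2 hpos)
    refine lt_irrefl (1 : ℝ) (lt_of_lt_of_le ?_ hlt.le)
    exact (div_lt_iff₀ hsq).1 (hn.trans_le (le_abs_self _))
  have hps : Summable fun n => P.real (X n ⁻¹' Set.Ioi (r n)) := ENNReal.summable_toReal hp
  set Y : ℕ → Ω → ℝ := fun n ω => min (X n ω) (r n) with hY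
  have hYm : ∀ n, Measurable (Y n) := fun n => (hm n).min measurable_const
  have hYi : iIndepFun Y P := hX.comp (fun n t => min t (r n)) fun n => by fun_prop
  have hY0 : ∀ n, ∀ᵐ ω ∂P, 0 ≤ Y n ω := fun n => (hnonneg n).mono fun ω h => le_min h (hr0 n)
  have hYb : ∀ n, ∀ᵐ ω ∂P, ‖Y n ω‖ ≤ r n := fun n => (hY0 n).mono fun ω h => by
    rw [Real.norm_of_nonneg h]; exact min_le_right _ _
  have hY2 : ∀ n, MemLp (Y n) 2 P := fun n =>
    MemLp.of_bound (hYm n).aestronglyMeasurable _ (hYb n)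
  have hY1 : ∀ n, Integrable (Y n) P := fun n => (hY2 n).integrable one_le_two
  have hX1 : ∀ᶠ n in atTop, Integrable (X n) P := hC.mono fun n hn =>
    Integrable.of_bound (hm n).aestronglyMeasurable C hn
  have hEev : ∀ᶠ n : ℕ in atTop, b / n ≤ ∫ ω, X n ω ∂P ∧ ∫ ω, X n ω ∂P ≤ (c + 1) / n := by
    filter_upwards [hE.eventually_const_le hbc, hE.eventually_le_const (lt_add_one c),
      eventually_gt_atTop 0] with n h1 h2 hn
    have hn' : (0 : ℝ) < n := Nat.cast_pos.2 hn
    rw [div_le_iff₀' hn', le_div_iff₀' hn']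
    exact ⟨h1, h2⟩
  have hv : Summable fun n => variance (Y n) P := by
    refine summable_of_isBigO_nat
      ((Real.summable_one_div_nat_rpow (p := 3 / 2)).2 (by norm_num)) ?_
    refine Asymptotics.IsBigO.of_bound (c + 1) ?_
    filter_upwards [hEev, hX1, eventually_gt_atTop 0] with n hn hXn hpos
    rw [Real.norm_of_nonneg (variance_nonneg _ _), Real.norm_of_nonneg (by positivity)]
    have hn' : (0 : ℝ) < n := Nat.cast_pos.2 hpos
    have hsq : ∫ ω, (Y n ^ 2) ω ∂P ≤ ∫ ω, r n * X n ω ∂P := by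
      refine integral_mono_ae (hY2 n).integrable_sq (hXn.const_mul _) ?_
      filter_upwards [hY0 n] with ω hω
      rw [Pi.pow_apply, sq]
      exact mul_le_mul (min_le_right _ _) (min_le_left _ _) hω (hr0 n)
    have hmul : (n : ℝ) ^ (3 / 2 : ℝ) = n * √n := by
      rw [Real.sqrt_eq_rpow, show (3 / 2 : ℝ) = 1 + 1 / 2 by norm_num, Real.rpow_add hn',
        Real.rpow_one]
    calc variance (Y n) P ≤ ∫ ω, (Y n ^ 2) ω ∂P := variance_le_expectation_sq (hYm n).aestronglyMeasurable
      _ ≤ r n * ∫ ω, X n ω ∂P := by rwa [integral_const_mul] at hsq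
      _ ≤ r n * ((c + 1) / n) := mul_le_mul_of_nonneg_left hn.2 (hr0 n)
      _ = (c + 1) * (1 / (n : ℝ) ^ (3 / 2 : ℝ)) := by rw [hmul, hr]; field_simp
  -- Integrate `X ≤ Y + C * 1_{X > r}`.
  have hdiff : ∀ᶠ n in atTop,
      b / n - C * P.real (X n ⁻¹' Set.Ioi (r n)) ≤ ∫ ω, Y n ω ∂P := by
    filter_upwards [hEev, hX1, hC] with n hn hXn hCn
    have hS : MeasurableSet (X n ⁻¹' Set.Ioi (r n)) := hm n measurableSet_Ioi
    have : ∫ ω, X n ω ∂P ≤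
        ∫ ω, (Y n ω + (X n ⁻¹' Set.Ioi (r n)).indicator (fun _ => C) ω) ∂P := by
      refine integral_mono_ae hXn ((hY1 n).add ((integrable_const C).indicator hS)) ?_
      filter_upwards [hCn, hY0 n] with ω hω hω0
      by_cases h : ω ∈ X n ⁻¹' Set.Ioi (r n)
      · rw [Set.indicator_of_mem h]
        linarith [le_abs_self (X n ω)]
      · rw [Set.indicator_of_notMem h, add_zero]
        exact (min_eq_left (not_lt.1 h)).ge
    rw [integral_add (hY1 n) ((integrable_const C).indicator hS), integral_indicator_const _ hS,
      smul_eq_mul, mul_comm] at this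
    linarith [hn.1]
  obtain ⟨K₁, hK₁⟩ := exists_sum_le_of_eventually_le hdiff
  filter_upwards [ae_bounded_sum_sub_integral hYi hYm hY2 hv, ae_all_iff.2 hnonneg]
    with ω ⟨K₂, hK₂⟩ hω
  obtain ⟨K, hK⟩ := exists_nat_ge
    (K₁ + K₂ + |C| * ∑' n, P.real (X n ⁻¹' Set.Ioi (r n)))
  refine ⟨K, fun N => ?_⟩
  have h1 := hK₁ N
  have h2 := (abs_le.1 (hK₂ N)).1
  have h3 : ∑ n ∈ Finset.range N, Y n ω ≤ ∑ n ∈ Finset.range N, X n ω :=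
    Finset.sum_le_sum fun n _ => min_le_left _ _
  have h4 := mul_le_mul_of_nonneg_left (log_le_sum_range_inv N) hb
  have h5 := hps.sum_le_tsum (Finset.range N) fun n _ => measureReal_nonneg
  have h6 : C * ∑ n ∈ Finset.range N, P.real (X n ⁻¹' Set.Ioi (r n)) ≤
      |C| * ∑' n, P.real (X n ⁻¹' Set.Ioi (r n)) :=
    mul_le_mul (le_abs_self C) h5 (Finset.sum_nonneg fun n _ => measureReal_nonneg) (abs_nonneg C)
  rw [Finset.sum_sub_distrib] at h1 h2
  simp only [div_eq_mul_one_div b, ← Finset.mul_sum] at h1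
  linarith

end Series

/-! ### The random model and the fate of its fires -/

section Driving

variable {Ω : Type*} [MeasurableSpace Ω] {P : Measure Ω} {ξ Δ : ℕ → ℕ → Ω → ℝ}

theorem measure_eq_one_of_ae [IsProbabilityMeasure P] {s : Set Ω} (h : ∀ᵐ ω ∂P, ω ∈ s) :
    P s = 1 := by
  rw [← measure_univ (μ := P)]
  exact measure_congr (eventuallyEq_univ.2 h)

theorem measure_lt_growth [IsProbabilityMeasure P] (hd : IsDriving P ξ Δ) (x i : ℕ) {t : ℝ}
    (ht : 0 ≤ t) : P {ω | t < ξ x i ω} = ENNReal.ofReal (Real.exp (-t)) := by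
  have := isProbabilityMeasure_expMeasure one_pos
  have h1 : P {ω | t < ξ x i ω} = expMeasure 1 (Set.Iic t)ᶜ := by
    rw [← hd.law_growth x i, Set.compl_Iic, Measure.map_apply (hd.measurable_growth x i)
      measurableSet_Ioi]
    rfl
  rw [h1, prob_compl_eq_one_sub measurableSet_Iic, ← ofReal_cdf, cdf_expMeasure_eq one_pos,
    if_pos ht, ← ENNReal.ofReal_one, ← ENNReal.ofReal_sub _ (by simpa using ht)]
  simp

theorem ae_growth_nonneg [IsProbabilityMeasure P] (hd : IsDriving P ξ Δ) :
    ∀ᵐ ω ∂P, ∀ x i, 0 ≤ ξ x i ω := by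
  refine ae_all_iff.2 fun x => ae_all_iff.2 fun i => ?_
  have h : ∀ᵐ ω ∂P, 0 < ξ x i ω := by
    exact (mem_ae_iff_prob_eq_one
      (measurableSet_lt measurable_const (hd.measurable_growth x i))).2
      (by simpa using measure_lt_growth hd x i le_rfl)
  exact h.mono fun ω h => h.le

theorem ae_spread_nonneg (hd : IsDriving P ξ Δ) : ∀ᵐ ω ∂P, ∀ x k, 0 ≤ Δ x k ω :=
  ae_all_iff.2 fun x => ae_all_iff.2 fun k => hd.spread_nonneg x k

theorem iIndepFun_growth (hd : IsDriving P ξ Δ) {p : ℕ → ℕ × ℕ} (hp : p.Injective) :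
    iIndepFun (fun n => ξ (p n).1 (p n).2) P :=
  hd.indep.precomp (g := fun n => Sum.inl (p n)) (Sum.inl_injective.comp hp)

theorem iIndepFun_spread (hd : IsDriving P ξ Δ) (k : ℕ) : iIndepFun (fun x => Δ x k) P :=
  hd.indep.precomp (g := fun x => Sum.inr (x, k))
    (Sum.inr_injective.comp fun _ _ h => congrArg Prod.fst h)

theorem ae_frequently_lt_growth [IsProbabilityMeasure P] (hd : IsDriving P ξ Δ) {p : ℕ → ℕ × ℕ}
    (hp : p.Injective) {t : ℕ → ℝ} (ht : ∀ n, 0 ≤ t n)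
    (hsum : ¬ Summable fun n => Real.exp (-t n)) :
    ∀ᵐ ω ∂P, ∃ᶠ n in atTop, t n < ξ (p n).1 (p n).2 ω := by
  refine ae_frequently_mem_of_tsum_eq_top (B := fun n => Set.Ioi (t n)) (iIndepFun_growth hd hp)
    (fun n => hd.measurable_growth _ _) (fun n => measurableSet_Ioi) ?_
  by_contra htop
  refine hsum (((ENNReal.summable_toReal htop)).congr fun n => ?_)
  have := measure_lt_growth hd (p n).1 (p n).2 (ht n)
  change (P {ω | t n < ξ (p n).1 (p n).2 ω}).toReal = _
  rw [this, ENNReal.toReal_ofReal (Real.exp_pos _).le]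

theorem ae_eventually_growth_le [IsProbabilityMeasure P] (hd : IsDriving P ξ Δ) {b : ℝ}
    (hb : 1 < b) : ∀ᵐ ω ∂P, ∀ᶠ x : ℕ in atTop, ξ x 0 ω ≤ b * Real.log x := by
  have hs : Summable fun n : ℕ => 1 / (n : ℝ) ^ b := Real.summable_one_div_nat_rpow.2 hb
  have hle : ∀ n : ℕ, P {ω | b * Real.log (n + 1 : ℕ) < ξ (n + 1) 0 ω} ≤
      ENNReal.ofReal (1 / ((n + 1 : ℕ) : ℝ) ^ b) := fun n => by
    have hlog : 0 ≤ Real.log (n + 1 : ℕ) := Real.log_natCast_nonneg _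
    rw [measure_lt_growth hd _ _ (mul_nonneg (by linarith) hlog), one_div,
      Real.rpow_def_of_pos (by positivity), ← Real.exp_neg, mul_comm]
  have hfin : ∑' n : ℕ, P {ω | b * Real.log (n + 1 : ℕ) < ξ (n + 1) 0 ω} ≠ ⊤ :=
    ne_top_of_le_ne_top ((summable_nat_add_iff 1).2 hs).tsum_ofReal_ne_top
      (ENNReal.tsum_le_tsum hle)
  filter_upwards [ae_eventually_notMem hfin] with ω hω
  rw [← map_add_atTop_eq_nat 1, eventually_map]
  exact hω.mono fun n hn => not_lt.1 hn

theorem ae_tendsto_sum_growth [IsProbabilityMeasure P] (hd : IsDriving P ξ Δ) :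
    ∀ᵐ ω ∂P, Tendsto (fun n => ∑ i ∈ Finset.range n, ξ 0 i ω) atTop atTop := by
  have hfreq : ∀ᵐ ω ∂P, ∃ᶠ n in atTop, 1 < ξ 0 n ω :=
    ae_frequently_lt_growth hd (p := fun n => (0, n)) (fun _ _ h => congrArg Prod.snd h)
      (t := fun _ => 1) (fun _ => zero_le_one) fun h => by
        exact (Real.exp_pos _).ne' ((summable_const_iff _).1 h)
  filter_upwards [hfreq, ae_growth_nonneg hd] with ω hω hnonneg
  refine (not_summable_iff_tendsto_nat_atTop_of_nonneg fun i => hnonneg 0 i).1 fun hs => ?_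
  obtain ⟨n, hn, hlt⟩ := (hω.and_eventually
    (hs.tendsto_atTop_zero.eventually_lt_const one_pos)).exists
  exact hn.not_gt hlt

/-- The times at which the first trees appear, together with the spreading times of one fire, have
a law that does not depend on the fire. -/
theorem map_firstTrees_spread [IsProbabilityMeasure P] (hd : IsDriving P ξ Δ) (k : ℕ) :
    P.map (fun ω (s : ℕ ⊕ ℕ) => Sum.elim (fun x => ξ x 0) (fun x => Δ x k) s ω) =
      P.map (fun ω (s : ℕ ⊕ ℕ) => Sum.elim (fun x => ξ x 0) (fun x => Δ x 0) s ω) := by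
  have h : ∀ k, P.map (fun ω (s : ℕ ⊕ ℕ) => Sum.elim (fun x => ξ x 0) (fun x => Δ x k) s ω) =
      Measure.infinitePi fun s : ℕ ⊕ ℕ =>
        P.map (Sum.elim (fun x => ξ x 0) (fun x => Δ x k) s) := fun k => by
    refine iIndepFun.map_fun_eq_infinitePi_map ?_ ?_
    · rintro (x | x)
      · exact hd.measurable_growth x 0
      · exact hd.measurable_spread x k
    · have := hd.indep.precomp (g := Sum.map (fun x => (x, 0)) (fun x => (x, k)))
        (Function.Injective.sumMap (fun _ _ h => congrArg Prod.fst h)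
          fun _ _ h => congrArg Prod.fst h)
      convert this using 1
      ext s
      rcases s with x | x <;> rfl
  rw [h k, h 0]
  congr 1
  ext1 s
  rcases s with x | x
  · rfl
  · exact (hd.identDistrib_spread x k).map_eq

theorem measurable_firstTrees_spread (hd : IsDriving P ξ Δ) (k : ℕ) :
    Measurable fun ω (s : ℕ ⊕ ℕ) => Sum.elim (fun x => ξ x 0) (fun x => Δ x k) s ω := by
  refine measurable_pi_lambda _ ?_
  rintro (x | x)
  · exact hd.measurable_growth x 0
  · exact hd.measurable_spread x k

theorem measure_firstTrees_spread [IsProbabilityMeasure P] (hd : IsDriving P ξ Δ) (k : ℕ)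
    {A : Set (ℕ ⊕ ℕ → ℝ)} (hA : MeasurableSet A) :
    P {ω | (fun s => Sum.elim (fun x => ξ x 0) (fun x => Δ x k) s ω) ∈ A} =
      P {ω | (fun s => Sum.elim (fun x => ξ x 0) (fun x => Δ x 0) s ω) ∈ A} := by
  have h := congrArg (· A) (map_firstTrees_spread hd k)
  simp only [Measure.map_apply (measurable_firstTrees_spread hd _) hA] at h
  exact h

/-- The hypotheses of the theorem concern fire `0` only; equality of the joint laws carries almost
sure properties over to every fire. -/
theorem ae_spread_of_ae_zero [IsProbabilityMeasure P] (hd : IsDriving P ξ Δ)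
    {A : Set (ℕ → ℝ)} (hA : MeasurableSet A) (h : ∀ᵐ ω ∂P, (fun x => Δ x 0 ω) ∈ A) (k : ℕ) :
    ∀ᵐ ω ∂P, (fun x => Δ x k ω) ∈ A := by
  have hr : Measurable fun (z : ℕ ⊕ ℕ → ℝ) (x : ℕ) => z (Sum.inr x) := by fun_prop
  have hA' : MeasurableSet {z : ℕ ⊕ ℕ → ℝ | (fun x => z (Sum.inr x)) ∉ A} := hr hA.compl
  exact (measure_firstTrees_spread hd k hA').trans h

theorem ae_rightmost_lt_top [IsProbabilityMeasure P] (hd : IsDriving P ξ Δ)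
    (h : ∀ᵐ ω ∂P, ∃ K : ℕ, ∀ N : ℕ, ∑ y ∈ Finset.range N, Δ y 0 ω ≤ K + Real.log N) :
    ∀ᵐ ω ∂P, ∀ k, rightmost (fun x i => ξ x i ω) (fun x i => Δ x i ω) k < ⊤ := by
  have hall : ∀ᵐ ω ∂P, ∀ k, ∃ K : ℕ, ∀ N : ℕ,
      ∑ y ∈ Finset.range N, Δ y k ω ≤ K + Real.log N := by
    refine ae_all_iff.2 fun k => ae_spread_of_ae_zero hd (A := {z | ∃ K : ℕ, ∀ N : ℕ,
      ∑ y ∈ Finset.range N, z y ≤ K + Real.log N}) ?_ h k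
    simp only [Set.ofPred_exists, Set.ofPred_forall]
    refine MeasurableSet.iUnion fun K => MeasurableSet.iInter fun N => ?_
    exact measurableSet_le (by fun_prop) measurable_const
  have hfreq : ∀ᵐ ω ∂P, ∀ K : ℕ, ∃ᶠ x : ℕ in atTop,
      K + Real.log (x + 1 : ℕ) < ξ (x + 1) 0 ω := by
    refine ae_all_iff.2 fun K => ae_frequently_lt_growth hd (p := fun x => (x + 1, 0))
      (fun x y h => by simpa using h)
      (t := fun x : ℕ => K + Real.log (x + 1 : ℕ))
      (fun x => add_nonneg K.cast_nonneg (Real.log_natCast_nonneg _)) fun hs => ?_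
    -- Multiplying the tail probabilities by `exp K` leaves the harmonic series.
    refine Real.not_summable_one_div_natCast ((summable_nat_add_iff 1).1
      ((hs.mul_left (Real.exp K)).congr fun x => ?_))
    rw [← Real.exp_add, ← sub_eq_add_neg, sub_add_cancel_left, Real.exp_neg,
      Real.exp_log (by positivity), one_div]
  filter_upwards [hall, hfreq] with ω hΔ hξ k
  refine (exists_not_reaches (fun k => ?_) k).elim fun x hx => rightmost_lt_top hx
  obtain ⟨K, hK⟩ := hΔ k
  obtain ⟨K', hK'⟩ := exists_nat_ge (∑ i ∈ Finset.range (k + 1), ξ 0 i ω + K)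
  refine (hξ K').mono fun x hx => lt_of_le_of_lt ?_ hx
  rw [fireTime]
  linarith [hK (x + 1)]

/-- The first fire that reaches the site `L` burns everything with a probability that is at least
the probability that its spreading times alone suffice for this. -/
theorem measure_le_measure_exists_reaches [IsProbabilityMeasure P] (hd : IsDriving P ξ Δ) (L : ℕ) :
    P {ω | ∀ x, L < x → ξ x 0 ω ≤ ∑ y ∈ Finset.range x, Δ y 0 ω} ≤
      P {ω | ∃ k, ∀ x, Reaches (fun x i => ξ x i ω) (fun x i => Δ x i ω) x k} := by
  set Z : (ℕ × ℕ) ⊕ (ℕ × ℕ) → Ω → ℝ :=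
    Sum.elim (fun p : ℕ × ℕ => ξ p.1 p.2) (fun p : ℕ × ℕ => Δ p.1 p.2) with hZ
  have hZm : ∀ s, Measurable (Z s) := by
    rintro (p | p)
    · exact hd.measurable_growth _ _
    · exact hd.measurable_spread _ _
  set B : ℕ → Set ((ℕ × ℕ) ⊕ (ℕ × ℕ) → ℝ) := fun m => {z |
    (∀ j < m, ¬ Reaches (fun x i => z (Sum.inl (x, i))) (fun x i => z (Sum.inr (x, i))) L j) ∧
      Reaches (fun x i => z (Sum.inl (x, i))) (fun x i => z (Sum.inr (x, i))) L m} with hB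
  set C : ℕ → Set ((ℕ × ℕ) ⊕ (ℕ × ℕ) → ℝ) := fun m => {z |
    ∀ x, L < x → z (Sum.inl (x, 0)) ≤ ∑ y ∈ Finset.range x, z (Sum.inr (y, m))} with hC
  have hR : ∀ x k, MeasurableSet {z : (ℕ × ℕ) ⊕ (ℕ × ℕ) → ℝ |
      Reaches (fun x i => z (Sum.inl (x, i))) (fun x i => z (Sum.inr (x, i))) x k} :=
    measurableSet_reaches (fun x i => by fun_prop) fun x i => by fun_prop
  have hBm : ∀ m, MeasurableSet (B m) := fun m => by
    have h : MeasurableSet (⋂ j, ⋂ (_ : j < m), {z : (ℕ × ℕ) ⊕ (ℕ × ℕ) → ℝ |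
        Reaches (fun x i => z (Sum.inl (x, i))) (fun x i => z (Sum.inr (x, i))) L j}ᶜ) :=
      MeasurableSet.iInter fun j => MeasurableSet.iInter fun _ => (hR L j).compl
    convert h.inter (hR L m) using 1
    ext z
    simp [hB]
  have hCm : ∀ m, MeasurableSet (C m) := fun m => by
    simp only [hC, Set.ofPred_forall]
    refine MeasurableSet.iInter fun x => MeasurableSet.iInter fun _ => ?_
    exact measurableSet_le (by fun_prop) (by fun_prop)
  have hZω : Measurable fun ω s => Z s ω := measurable_pi_lambda _ hZm
  set q := P {ω | ∀ x, L < x → ξ x 0 ω ≤ ∑ y ∈ Finset.range x, Δ y 0 ω} with hq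
  have hCq : ∀ m, P {ω | (fun s => Z s ω) ∈ C m} = q := fun m => by
    refine measure_firstTrees_spread hd m (A := {z : ℕ ⊕ ℕ → ℝ |
      ∀ x, L < x → z (Sum.inl x) ≤ ∑ y ∈ Finset.range x, z (Sum.inr y)}) ?_
    simp only [Set.ofPred_forall]
    refine MeasurableSet.iInter fun x => MeasurableSet.iInter fun _ => ?_
    exact measurableSet_le (by fun_prop) (by fun_prop)
  have hharris : ∀ m, P {ω | (fun s => Z s ω) ∈ B m} * q ≤
      P {ω | (fun s => Z s ω) ∈ B m ∧ (fun s => Z s ω) ∈ C m} := fun m => by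
    rw [← hCq m]
    refine mul_measure_le_measure_inter hd.indep hZm
      -- The two events share only the spreading times of fire `m` before `L`, in which both
      -- increase. `S` and `T` hold the rest: growth up to `L` with the earlier fires' spreading,
      -- and growth beyond `L` with the spreading of fire `m` from `L` on.
      (S := {s | (∃ x i, x ≤ L ∧ s = Sum.inl (x, i)) ∨ ∃ x j, j < m ∧ s = Sum.inr (x, j)})
      (T := {s | (∃ x i, L < x ∧ s = Sum.inl (x, i)) ∨ ∃ x, L ≤ x ∧ s = Sum.inr (x, m)})
      ?_ ((Finset.range L).image fun x => Sum.inr (x, m)) ?_ ?_ (hBm m) (hCm m) ?_ ?_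
    · rw [Set.disjoint_left]
      rintro _ (⟨x, i, hx, rfl⟩ | ⟨x, j, hj, rfl⟩)
      · rintro (⟨y, i', hy, h⟩ | ⟨y, hy, h⟩)
        · simp only [Sum.inl.injEq, Prod.mk.injEq] at h; omega
        · exact Sum.inl_ne_inr h
      · rintro (⟨y, i', hy, h⟩ | ⟨y, hy, h⟩)
        · exact Sum.inr_ne_inl h
        · simp only [Sum.inr.injEq, Prod.mk.injEq] at h; omega
    · simp only [Finset.mem_image, Finset.mem_range]
      rintro _ ⟨x, hx, rfl⟩ (⟨y, i', hy, h⟩ | ⟨y, j, hj, h⟩)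
      · exact Sum.inr_ne_inl h
      · simp only [Sum.inr.injEq, Prod.mk.injEq] at h; omega
    · simp only [Finset.mem_image, Finset.mem_range]
      rintro _ ⟨x, hx, rfl⟩ (⟨y, i', hy, h⟩ | ⟨y, hy, h⟩)
      · exact Sum.inr_ne_inl h
      · simp only [Sum.inr.injEq, Prod.mk.injEq] at h; omega
    · intro z z' hS hF hz
      have h := reaches_mono_spread (L := L) (m := m)
        (ξ := fun x i => z (Sum.inl (x, i))) (δ := fun x i => z (Sum.inr (x, i)))
        (ξ' := fun x i => z' (Sum.inl (x, i))) (δ' := fun x i => z' (Sum.inr (x, i)))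
        (fun x hx => funext fun i => hS _ (Or.inl ⟨x, i, hx, rfl⟩))
        (fun x hx j hj => hS _ (Or.inr ⟨x, j, hj, rfl⟩))
        (fun x hx => hF _ (Finset.mem_image.2 ⟨x, Finset.mem_range.2 hx, rfl⟩)) le_rfl
      exact ⟨fun j hj hj' => hz.1 j hj ((h.1 j hj).2 hj'), h.2 hz.2⟩
    · intro z z' hT hF hz x hx
      rw [← hT _ (Or.inl ⟨x, 0, hx, rfl⟩)]
      refine (hz x hx).trans (Finset.sum_le_sum fun y _ => ?_)
      rcases lt_or_ge y L with hy | hy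
      · exact hF _ (Finset.mem_image.2 ⟨y, Finset.mem_range.2 hy, rfl⟩)
      · exact (hT _ (Or.inr ⟨y, hy, rfl⟩)).le
  have hdisj : Pairwise (Function.onFun Disjoint fun m => {ω | (fun s => Z s ω) ∈ B m}) := by
    refine (Std.Symm.pairwise_on (r := Disjoint) _).2 fun m n hmn => ?_
    exact Set.disjoint_left.2 fun ω hm hn => hn.1 m hmn hm.2
  have hcover : ∀ᵐ ω ∂P, ω ∈ ⋃ m, {ω | (fun s => Z s ω) ∈ B m} := by
    classical
    filter_upwards [ae_tendsto_sum_growth hd, ae_spread_nonneg hd] with ω h1 h2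
    have hex : ∃ k, Reaches (fun x i => ξ x i ω) (fun x i => Δ x i ω) L k :=
      (frequently_reaches h2 h1 L).exists
    exact Set.mem_iUnion.2 ⟨Nat.find hex, fun j hj => Nat.find_min hex hj, Nat.find_spec hex⟩
  calc q = P (⋃ m, {ω | (fun s => Z s ω) ∈ B m}) * q := by
        rw [measure_eq_one_of_ae hcover, one_mul]
    _ = ∑' m, P {ω | (fun s => Z s ω) ∈ B m} * q := by
        rw [measure_iUnion hdisj fun m => hZω (hBm m), ENNReal.tsum_mul_right]
    _ ≤ ∑' m, P {ω | (fun s => Z s ω) ∈ B m ∧ (fun s => Z s ω) ∈ C m} :=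
        ENNReal.tsum_le_tsum hharris
    _ = P (⋃ m, {ω | (fun s => Z s ω) ∈ B m ∧ (fun s => Z s ω) ∈ C m}) := by
        refine (measure_iUnion (fun m n hmn => ?_) fun m => hZω ((hBm m).inter (hCm m))).symm
        exact (hdisj hmn).mono (fun ω h => h.1) fun ω h => h.1
    _ ≤ _ := by
        refine measure_mono_ae ?_
        filter_upwards [ae_growth_nonneg hd] with ω hω hmem
        obtain ⟨m, hm, hmC⟩ := Set.mem_iUnion.1 hmem
        refine ⟨m, reaches_of_first hm.1 hm.2 fun x hx => (hmC x hx).trans ?_⟩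
        exact le_add_of_nonneg_left (Finset.sum_nonneg fun i _ => hω 0 i)

theorem ae_exists_isInfiniteFire [IsProbabilityMeasure P] (hd : IsDriving P ξ Δ) {b : ℝ}
    (hb : 1 < b) (h : ∀ᵐ ω ∂P, ∃ K : ℕ, ∀ N : ℕ,
      b * Real.log N ≤ K + ∑ y ∈ Finset.range N, Δ y 0 ω) :
    ∀ᵐ ω ∂P, ∃ k, IsInfiniteFire (fun x i => ξ x i ω) (fun x i => Δ x i ω) k := by
  have hlog : Tendsto (fun N : ℕ => Real.log N) atTop atTop :=
    Real.tendsto_log_atTop.comp tendsto_natCast_atTop_atTop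
  have hall : ∀ᵐ ω ∂P, ∀ k, ∃ K : ℕ, ∀ N : ℕ,
      b * Real.log N ≤ K + ∑ y ∈ Finset.range N, Δ y k ω := by
    refine ae_all_iff.2 fun k => ae_spread_of_ae_zero hd (A := {z | ∃ K : ℕ, ∀ N : ℕ,
      b * Real.log N ≤ K + ∑ y ∈ Finset.range N, z y}) ?_ h k
    simp only [Set.ofPred_exists, Set.ofPred_forall]
    refine MeasurableSet.iUnion fun K => MeasurableSet.iInter fun N => ?_
    exact measurableSet_le measurable_const (by fun_prop)
  have hL : ∀ᵐ ω ∂P, ω ∈ ⋃ L : ℕ,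
      {ω | ∀ x, L < x → ξ x 0 ω ≤ ∑ y ∈ Finset.range x, Δ y 0 ω} := by
    -- Growth times need a slope `b' > 1` for Borel-Cantelli; the surplus `(b - b') * log x` absorbs
    -- `K`.
    obtain ⟨b', hb1, hb'⟩ := exists_between hb
    filter_upwards [ae_eventually_growth_le hd hb1, h] with ω hω ⟨K, hK⟩
    obtain ⟨L, hL⟩ := eventually_atTop.1
      (hω.and ((hlog.const_mul_atTop (sub_pos.2 hb')).eventually_ge_atTop (K : ℝ)))
    refine Set.mem_iUnion.2 ⟨L, fun x hx => ?_⟩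
    obtain ⟨h1, h2⟩ := hL x hx.le
    linarith [hK x]
  have hmono : Monotone fun L : ℕ =>
      {ω | ∀ x, L < x → ξ x 0 ω ≤ ∑ y ∈ Finset.range x, Δ y 0 ω} :=
    fun L L' hLL ω hω x hx => hω x (hLL.trans_lt hx)
  have hone : P {ω | ∃ k, ∀ x, Reaches (fun x i => ξ x i ω) (fun x i => Δ x i ω) x k} = 1 := by
    refine le_antisymm prob_le_one ?_
    rw [← measure_eq_one_of_ae hL, hmono.measure_iUnion]
    exact iSup_le fun L => measure_le_measure_exists_reaches hd L
  have hex : ∀ᵐ ω ∂P, ∃ k, ∀ x, Reaches (fun x i => ξ x i ω) (fun x i => Δ x i ω) x k := by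
    refine (mem_ae_iff_prob_eq_one ?_).2 hone
    simp only [Set.ofPred_exists, Set.ofPred_forall]
    exact MeasurableSet.iUnion fun k => MeasurableSet.iInter fun x =>
      measurableSet_reaches hd.measurable_growth hd.measurable_spread x k
  filter_upwards [hex, hall, ae_spread_nonneg hd] with ω ⟨k, hk⟩ hS hnonneg
  refine ⟨k, isInfiniteFire_of_forall_reaches hk (fun x => hnonneg x k) ?_⟩
  obtain ⟨K, hK⟩ := hS k
  refine tendsto_atTop_mono (fun N => ?_)
    (tendsto_atTop_add_const_right _ (-(K : ℝ)) (hlog.const_mul_atTop (zero_lt_one.trans hb)))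
  linarith [hK N]

end Driving

end ForestFire

theorem mainTheorem5 {Ω : Type*} [MeasurableSpace Ω] (P : Measure Ω) [IsProbabilityMeasure P]
    (ξ Δ : ℕ → ℕ → Ω → ℝ) (hdrive : ForestFire.IsDriving P ξ Δ) (c : ℝ) :
    (c ≤ 1 →
      ((∀ᵐ ω ∂P, ∀ᶠ x : ℕ in atTop, Δ x 0 ω ≤ c / x) ∨
        ((∃ C : ℝ, 0 < C ∧ ∀ x, ∀ᵐ ω ∂P, |Δ x 0 ω| ≤ C) ∧
          Summable (fun x : ℕ => variance (Δ x 0) P) ∧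
          ∃ l : ℝ, Tendsto
            (fun N : ℕ => ∑ x ∈ Finset.Icc 1 N, ((∫ ω, Δ x 0 ω ∂P) - c / x)) atTop (𝓝 l))) →
      ∀ᵐ ω ∂P, ∀ k,
        ForestFire.rightmost (fun x i => ξ x i ω) (fun x i => Δ x i ω) k < ⊤) ∧
    (1 < c →
      ((∀ᵐ ω ∂P, ∀ᶠ x : ℕ in atTop, c / x < Δ x 0 ω) ∨
        (Tendsto (fun x : ℕ => (x : ℝ) * ∫ ω, Δ x 0 ω ∂P) atTop (𝓝 c) ∧
          (∀ᵐ ω ∂P, Tendsto (fun x : ℕ => |Δ x 0 ω| * √(x : ℝ)) atTop (𝓝 0)) ∧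
          ∃ C : ℝ, 0 < C ∧ ∀ᶠ x : ℕ in atTop, ∀ᵐ ω ∂P, |Δ x 0 ω| ≤ C)) →
      ∀ᵐ ω ∂P, ∃ k,
        ForestFire.IsInfiniteFire (fun x i => ξ x i ω) (fun x i => Δ x i ω) k) := by
  have hi := ForestFire.iIndepFun_spread hdrive 0
  have hm : ∀ x, Measurable (Δ x 0) := fun x => hdrive.measurable_spread x 0
  refine ⟨fun hc h => ForestFire.ae_rightmost_lt_top hdrive ?_, fun hc h => ?_⟩
  · rcases h with h | ⟨⟨C, -, hC⟩, hv, l, hl⟩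
    · exact ForestFire.ae_sum_le_log_of_eventually_le hc h
    · exact ForestFire.ae_sum_le_log_of_summable_variance hi hm hc hC hv hl
  · rcases h with h | ⟨hE, h0, C, -, hC⟩
    · exact ForestFire.ae_exists_isInfiniteFire hdrive hc
        (ForestFire.ae_log_le_sum_of_eventually_lt hc h)
    -- The asymptotics of the means are used only through a slope strictly below `c`, which can
    -- still exceed `1`.
    · obtain ⟨b, hb, hbc⟩ := exists_between hc
      exact ForestFire.ae_exists_isInfiniteFire hdrive hb
        (ForestFire.ae_log_le_sum_of_tendsto_integral hi hm (fun x => hdrive.spread_nonneg x 0)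
          (zero_le_one.trans hb.le) hbc hE h0 hC)
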